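/- Let $d \ge 1$ and let $D \subset \mathbb R^d$ be a bounded open set (for instance a bounded Lipschitz domain in $\mathbb R^2$ or $\mathbb R^3$). Let $H_0^1(D)$ be the closure of $C_c^\infty(D)$ in the norm $\|u\|_{H_0^1(D)} = (\|u\|_{L^2(D)}^2 + \|\nabla u\|_{L^2(D)}^2)^{1/2}$, and let $L^\infty_+(D) = \{a \in L^\infty(D) : \operatorname{ess\,inf} a > 0\}$. Equip the data space $\mathcal X = L^\infty_+(D) \times L^2(D)$ with the metric $$d_{\mathcal X}\big((a_1,f_1),(a_2,f_2)\big) = \|\log a_1 - \log a_2\|_{L^\infty(D)} + \|f_1 - f_2\|_{L^2(D)},$$ and equip $\mathcal X$, $\mathcal X\times\mathcal X$, $H_0^1(D)$ and $H_0^1(D)\times H_0^1(D)$ with their Borel $\sigma$-algebras. For a metric space $(Y, d_Y)$ and $p \ge 1$ let $\mathcal P_p(Y)$ be the set of Borel probability measures $\mu$ on $Y$ with $\int d_Y(y,y_0)^p\,\mu(\mathrm dy) < \infty$ for some $y_0 \in Y$, and let $$d_p(\mu,\nu) = \inf_{\pi} \Big(\iint d_Y(y,z)^p \,\pi(\mathrm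 dy,\mathrm dz)\Big)^{1/p} \in [0,\infty],$$ where the infimum is over all Borel measures $\pi$ on $Y\times Y$ with marginals $\mu$ and $\nu$ ($\inf\emptyset = \infty$). Then for every $(a,f) \in \mathcal X$ there is exactly one $u \in H_0^1(D)$ with $$\int_D a\,\nabla u\cdot\nabla v \,\mathrm dx = \int_D f v\,\mathrm dx \qquad \text{for all } v \in H_0^1(D),$$ the solution operator $\mathcal S\colon \mathcal X \to H_0^1(D)$, $(a,f)\mapsto u$, is Borel measurable, and there is a constant $c > 0$, depending only on $D$, such that the following holds for all real $r$ and all real $p \ge 1$. If $P$ and $Q$ are Borel probability measures on $\mathcal X$ that are supported in $$B_r = \{(a,f) \in \mathcal X : \|\log a\|_{L^\infty(D)} \le r,\ \|f\|_{L^2(D)} \le r\},$$ that is, $P(B_r) = Q(B_r) = 1$, then the pushforward measures satisfy $\mathcal S_*P, \mathcal S_*Q \in \mathcal P_p(H_0^1(D))$ and $$d_p(\mathcal S_*P, \mathcal S_*Q) \le c\,(1+r)\,e^{3r}\, d_p(P,Q).$$ -/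

import Mathlib

open MeasureTheory Set
open scoped ENNReal ContDiff Gradient

noncomputable section

/-! ### Wasserstein distances on metric spaces

The product `X × X` carries its own Borel σ-algebra (for a nonseparable `X` this may be larger
than the product of the Borel σ-algebras of the factors); all distances are extended
nonnegative reals, so an infimum over an empty set of couplings is `∞`. -/

section Wasserstein

variable {X : Type*} [MetricSpace X] [MeasurableSpace X]

/-- `P ∈ 𝒫_p(X)`: a probability measure with a finite `p`-th moment. -/
def HasFiniteMoment (p : ℝ) (P : Measure X) : Prop :=
  IsProbabilityMeasure P ∧ ∃ x₀ : X, ∫⁻ x, edist x x₀ ^ p ∂P < ⊤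

/-- `π` is a Borel measure on `X × X` with marginals `P` and `Q`. -/
def IsCoupling (P Q : Measure X) (π : @Measure (X × X) (borel (X × X))) : Prop :=
  (∀ A : Set X, MeasurableSet A → π (A ×ˢ univ) = P A) ∧
    ∀ B : Set X, MeasurableSet B → π (univ ×ˢ B) = Q B

/-- The `p`-Wasserstein distance `inf_π (∬ d(x,y)^p π(dx,dy))^(1/p)`. -/
def wassersteinDist (p : ℝ) (P Q : Measure X) : ℝ≥0∞ :=
  ⨅ (π : @Measure (X × X) (borel (X × X))) (_ : IsCoupling P Q π),
    (@lintegral (X × X) (borel (X × X)) π fun z => edist z.1 z.2 ^ p) ^ (1 / p)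

end Wasserstein

section Elliptic

variable {d : ℕ}

/-- Scalar functions in `L^q(D)`, with respect to Lebesgue measure. -/
abbrev ScalarLp (D : Set (EuclideanSpace ℝ (Fin d))) (q : ℝ≥0∞) : Type :=
  Lp ℝ q (volume.restrict D)

/-- Vector fields in `L²(D; ℝᵈ)`. -/
abbrev VectorL2 (D : Set (EuclideanSpace ℝ (Fin d))) : Type :=
  Lp (EuclideanSpace ℝ (Fin d)) 2 (volume.restrict D)

/-! ### The Sobolev space `H₀¹(D)` -/

/-- The set of pairs `(φ, ∇φ)`, `φ ∈ C_c^∞(D)`, in `L²(D) × L²(D; ℝᵈ)`. -/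
def testGraph (D : Set (EuclideanSpace ℝ (Fin d))) :
    Submodule ℝ (WithLp 2 (ScalarLp D 2 × VectorL2 D)) where
  carrier := {w | ∃ φ : EuclideanSpace ℝ (Fin d) → ℝ,
    ContDiff ℝ ∞ φ ∧ HasCompactSupport φ ∧ tsupport φ ⊆ D ∧
      w.fst =ᵐ[volume.restrict D] φ ∧ w.snd =ᵐ[volume.restrict D] ∇ φ}
  zero_mem' := by
    refine ⟨0, contDiff_const, HasCompactSupport.zero, by simp [tsupport], ?_, ?_⟩
    · exact Lp.coeFn_zero _ _ _
    · have h : ∇ (0 : EuclideanSpace ℝ (Fin d) → ℝ) = 0 := by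
        funext x
        simp [gradient]
      rw [h]
      exact Lp.coeFn_zero _ _ _
  add_mem' := by
    rintro v w ⟨φ, hφ, cφ, sφ, v1, v2⟩ ⟨ψ, hψ, cψ, sψ, w1, w2⟩
    refine ⟨φ + ψ, hφ.add hψ, cφ.add cψ,
      (tsupport_add φ ψ).trans (union_subset sφ sψ), ?_, ?_⟩
    · filter_upwards [Lp.coeFn_add v.fst w.fst, v1, w1] with x h1 h2 h3
      simp only [WithLp.add_fst, Pi.add_apply] at h1 ⊢
      rw [h1, h2, h3]
    · filter_upwards [Lp.coeFn_add v.snd w.snd, v2, w2] with x h1 h2 h3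
      have h : ∇ (φ + ψ) x = ∇ φ x + ∇ ψ x := by
        simp only [gradient]
        rw [fderiv_add (hφ.differentiable (by simp) x) (hψ.differentiable (by simp) x), map_add]
      simp only [WithLp.add_snd, Pi.add_apply] at h1 ⊢
      rw [h1, h2, h3, h]
  smul_mem' := by
    rintro c w ⟨ψ, hψ, cψ, sψ, w1, w2⟩
    refine ⟨c • ψ, hψ.const_smul c, cψ.smul_left (f := fun _ => c),
      (tsupport_smul_subset_right (fun _ => c) ψ).trans sψ, ?_, ?_⟩
    · filter_upwards [Lp.coeFn_smul c w.fst, w1] with x h1 h3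
      simp only [WithLp.smul_fst, Pi.smul_apply] at h1 ⊢
      rw [h1, h3]
    · filter_upwards [Lp.coeFn_smul c w.snd, w2] with x h1 h3
      have h : ∇ (c • ψ) x = c • ∇ ψ x := by
        simp only [gradient]
        rw [fderiv_const_smul (hψ.differentiable (by simp) x), map_smul]
      simp only [WithLp.smul_snd, Pi.smul_apply] at h1 ⊢
      rw [h1, h3, h]

/-- `H₀¹(D)`, the closure of `C_c^∞(D)` in the norm `(‖u‖²_{L²} + ‖∇u‖²_{L²})^{1/2}`: an element
is the pair formed by a function `u` and its weak gradient `∇u`, the joint `L²` limit of pairs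
`(φ, ∇φ)` with `φ ∈ C_c^∞(D)`. -/
def sobolevH10 (D : Set (EuclideanSpace ℝ (Fin d))) :
    Submodule ℝ (WithLp 2 (ScalarLp D 2 × VectorL2 D)) :=
  (testGraph D).topologicalClosure

/-- `H₀¹(D)` as a type, with the norm inherited from `L²(D) × L²(D; ℝᵈ)`. -/
abbrev H10 (D : Set (EuclideanSpace ℝ (Fin d))) : Type := sobolevH10 D

/-- The underlying function of an element of `H₀¹(D)`. -/
def H10.fn {D : Set (EuclideanSpace ℝ (Fin d))} (u : H10 D) : ScalarLp D 2 := u.1.fst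

/-- The weak gradient of an element of `H₀¹(D)`. -/
def H10.grad {D : Set (EuclideanSpace ℝ (Fin d))} (u : H10 D) : VectorL2 D := u.1.snd

theorem H10.norm_sq {D : Set (EuclideanSpace ℝ (Fin d))} (u : H10 D) :
    ‖u‖ ^ 2 = ‖u.fn‖ ^ 2 + ‖u.grad‖ ^ 2 :=
  WithLp.prod_norm_sq_eq_of_L2 u.1

/-- `H₀¹(D)` carries its Borel σ-algebra. -/
instance H10.instMeasurableSpace (D : Set (EuclideanSpace ℝ (Fin d))) :
    MeasurableSpace (H10 D) := borel _

instance H10.instBorelSpace (D : Set (EuclideanSpace ℝ (Fin d))) : BorelSpace (H10 D) := ⟨rfl⟩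

/-! ### The data space `L^∞_+(D) × L²(D)` -/

/-- `L^∞_+(D)`: the functions in `L^∞(D)` that are bounded below by a positive constant a.e. -/
structure PosLinfty (D : Set (EuclideanSpace ℝ (Fin d))) : Type where
  toLp : ScalarLp D ∞
  uniformly_pos : ∃ m : ℝ, 0 < m ∧ ∀ᵐ x ∂(volume.restrict D), m ≤ toLp x

theorem PosLinfty.memLp_log {D : Set (EuclideanSpace ℝ (Fin d))} (a : PosLinfty D) :
    MemLp (fun x => Real.log (a.toLp x)) ∞ (volume.restrict D) := by
  obtain ⟨m, hm, h⟩ := a.uniformly_pos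
  refine memLp_top_of_bound
    (Real.measurable_log.comp_aemeasurable
      (Lp.aestronglyMeasurable a.toLp).aemeasurable).aestronglyMeasurable
    (|Real.log m| + |Real.log ‖a.toLp‖|) ?_
  have hb : ∀ᵐ x ∂(volume.restrict D), ‖a.toLp x‖ ≤ ‖a.toLp‖ := by
    have hfin : eLpNorm a.toLp ∞ (volume.restrict D) ≠ ⊤ := Lp.eLpNorm_ne_top _
    filter_upwards [ae_le_eLpNormEssSup (f := a.toLp) (μ := volume.restrict D)] with x hx
    rw [← eLpNorm_exponent_top] at hx
    rw [Lp.norm_def, ← toReal_enorm]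
    exact ENNReal.toReal_mono hfin hx
  filter_upwards [h, hb] with x h1 h2
  have h0 : 0 < a.toLp x := hm.trans_le h1
  have h3 : a.toLp x ≤ ‖a.toLp‖ := (le_abs_self _).trans h2
  have h4 := Real.log_le_log hm h1
  have h5 := Real.log_le_log h0 h3
  rw [Real.norm_eq_abs, abs_le]
  have h6 := neg_abs_le (Real.log m)
  have h7 := le_abs_self (Real.log ‖a.toLp‖)
  have h8 := abs_nonneg (Real.log m)
  have h9 := abs_nonneg (Real.log ‖a.toLp‖)
  constructor <;> linarith

/-- `log a ∈ L^∞(D)` for `a ∈ L^∞_+(D)`. -/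
def PosLinfty.log {D : Set (EuclideanSpace ℝ (Fin d))} (a : PosLinfty D) : ScalarLp D ∞ :=
  a.memLp_log.toLp _

/-- The data space `L^∞_+(D) × L²(D)`: pairs of a diffusion coefficient `a` and a source `f`. -/
@[ext]
structure DataSpace (D : Set (EuclideanSpace ℝ (Fin d))) : Type where
  a : PosLinfty D
  f : ScalarLp D 2

/-- The map `(a, f) ↦ (log a, f)` into the `ℓ¹`-product of `L^∞(D)` and `L²(D)`. -/
def DataSpace.logData {D : Set (EuclideanSpace ℝ (Fin d))} (x : DataSpace D) :
    WithLp 1 (ScalarLp D ∞ × ScalarLp D 2) :=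
  WithLp.toLp 1 (x.a.log, x.f)

theorem DataSpace.logData_injective (D : Set (EuclideanSpace ℝ (Fin d))) :
    Function.Injective (DataSpace.logData (D := D)) := by
  rintro ⟨⟨a, ha⟩, f⟩ ⟨⟨b, hb⟩, g⟩ h
  have h' := congrArg WithLp.ofLp h
  simp only [logData, Prod.mk.injEq] at h'
  obtain ⟨h1, rfl⟩ := h'
  have hab : a = b := by
    obtain ⟨m, hm, ha'⟩ := ha
    obtain ⟨n, hn, hb'⟩ := hb
    have h2 := (MemLp.toLp_eq_toLp_iff _ _).1 h1
    apply Lp.ext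
    filter_upwards [h2, ha', hb'] with x hx h3 h4
    exact Real.log_injOn_pos (Set.mem_Ioi.2 (hm.trans_le h3)) (Set.mem_Ioi.2 (hn.trans_le h4)) hx
  subst hab
  rfl

/-- The metric `‖log a₁ - log a₂‖_{L^∞} + ‖f₁ - f₂‖_{L²}` on the data space. -/
instance DataSpace.instMetricSpace (D : Set (EuclideanSpace ℝ (Fin d))) :
    MetricSpace (DataSpace D) :=
  MetricSpace.induced DataSpace.logData (DataSpace.logData_injective D) inferInstance

theorem DataSpace.dist_eq {D : Set (EuclideanSpace ℝ (Fin d))} (x y : DataSpace D) :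
    dist x y = ‖x.a.log - y.a.log‖ + ‖x.f - y.f‖ := by
  change dist x.logData y.logData = _
  rw [WithLp.prod_dist_eq_of_L1, dist_eq_norm, dist_eq_norm]
  rfl

/-- The data space carries its Borel σ-algebra. -/
instance DataSpace.instMeasurableSpace (D : Set (EuclideanSpace ℝ (Fin d))) :
    MeasurableSpace (DataSpace D) := borel _

instance DataSpace.instBorelSpace (D : Set (EuclideanSpace ℝ (Fin d))) :
    BorelSpace (DataSpace D) := ⟨rfl⟩

/-- The set of data with `‖log a‖_{L^∞} ≤ r` and `‖f‖_{L²} ≤ r`. -/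
def boundedData (D : Set (EuclideanSpace ℝ (Fin d))) (r : ℝ) : Set (DataSpace D) :=
  {x | ‖x.a.log‖ ≤ r ∧ ‖x.f‖ ≤ r}

/-! ### The elliptic problem -/

/-- `u ∈ H₀¹(D)` satisfies `(a ∇u, ∇v)_{L²} = (f, v)_{L²}` for all `v ∈ H₀¹(D)`. -/
def IsWeakSolution {D : Set (EuclideanSpace ℝ (Fin d))} (x : DataSpace D) (u : H10 D) : Prop :=
  ∀ v : H10 D,
    ∫ y in D, x.a.toLp y * inner ℝ (u.grad y) (v.grad y) = ∫ y in D, x.f y * v.fn y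

open Classical in
/-- The solution operator `(a, f) ↦ u`, with the value `0` at data without a weak solution. -/
def solutionOperator (D : Set (EuclideanSpace ℝ (Fin d))) (x : DataSpace D) : H10 D :=
  if h : ∃ u : H10 D, IsWeakSolution x u then h.choose else 0

end Elliptic

end

/-!
The solution operator `S` of the elliptic problem is Lipschitz on each `boundedData D r`, with
constant `c (1 + r) exp (3 r)`, and Wasserstein distances inherit Lipschitz constants.

*Lipschitz estimate.* Testing `∫ φ² = ∫ φ² ∂_i x_i` by parts gives the Poincaré inequality for test
functions in every dimension `d ≥ 1`, and it passes to the closure as `‖u‖ ≤ K ‖∇u‖` on `H₀¹(D)`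
(`exists_norm_le_mul_norm_grad`). If `‖log a‖ ≤ r`, then `exp (-r) ≤ a ≤ exp r` almost everywhere, so
the energy form is coercive with constant `exp (-r)` in the gradient norm. This gives existence by
Lax–Milgram (`existsUnique_isWeakSolution`), the bound `‖∇u‖ ≤ exp r · K ‖f‖`
(`IsWeakSolution.norm_grad_le`), and, applied to the equation for the difference of two solutions,
the estimate `‖u₁ - u₂‖ ≤ K² (1 + r) exp (3 r) d(x₁, x₂)` (`IsWeakSolution.norm_sub_le`), which
contains uniqueness. As every bounded set of data lies in some `boundedData D r`, `S` is continuous,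
and so Borel measurable.

*Wasserstein distance.* A coupling `π` of `P` and `Q` is carried by the product of `boundedData D r`
with itself, and its image under `S × S` couples the image measures with a cost that is larger by
at most the Lipschitz constant (`wassersteinDist_map_le`). The space of data need not be separable,
so `π` lives on a Borel σ-algebra that may exceed the product σ-algebra; it is the continuity of
`S × S`, rather than the measurability of `S`, that makes the image of `π` a Borel measure on the
product.
-/

/-! ### Wasserstein distances under maps that are Lipschitz on the support -/

section Wasserstein

variable {X Y : Type*} [MetricSpace X] [MeasurableSpace X] [MetricSpace Y] [MeasurableSpace Y]

/-- A coupling of measures carried by `s` is carried by `s × s`. The set `s` need not be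
measurable. -/
theorem IsCoupling.ae_mem_prod {P Q : Measure X} {π : @Measure (X × X) (borel (X × X))}
    (hπ : IsCoupling P Q π) {s : Set X} (hP : ∀ᵐ x ∂P, x ∈ s) (hQ : ∀ᵐ x ∂Q, x ∈ s) :
    let _ : MeasurableSpace (X × X) := borel (X × X)
    ∀ᵐ z ∂π, z.1 ∈ s ∧ z.2 ∈ s := by
  let _ : MeasurableSpace (X × X) := borel (X × X)
  rw [Filter.eventually_and]
  constructor
  · have h : π (toMeasurable P sᶜ ×ˢ univ) = 0 := by
      rw [hπ.1 _ (measurableSet_toMeasurable _ _), measure_toMeasurable]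
      exact hP
    exact measure_mono_null (fun z hz =>
      Set.mk_mem_prod (subset_toMeasurable P sᶜ hz) (mem_univ _)) h
  · have h : π (univ ×ˢ toMeasurable Q sᶜ) = 0 := by
      rw [hπ.2 _ (measurableSet_toMeasurable _ _), measure_toMeasurable]
      exact hQ
    exact measure_mono_null (fun z hz =>
      Set.mk_mem_prod (mem_univ _) (subset_toMeasurable Q sᶜ hz)) h

variable [BorelSpace X] [BorelSpace Y]

/-- Continuity of `T` makes `T × T` measurable for the Borel σ-algebras of the product spaces,
also where these are larger than the product σ-algebras. -/
theorem IsCoupling.map {P Q : Measure X} {π : @Measure (X × X) (borel (X × X))}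
    (hπ : IsCoupling P Q π) {T : X → Y} (hT : Continuous T) :
    IsCoupling (P.map T) (Q.map T)
      (@Measure.map (X × X) (Y × Y) (borel _) (borel _) (Prod.map T T) π) := by
  let _ : MeasurableSpace (X × X) := borel (X × X)
  let _ : MeasurableSpace (Y × Y) := borel (Y × Y)
  have : BorelSpace (X × X) := ⟨rfl⟩
  have : BorelSpace (Y × Y) := ⟨rfl⟩
  have hTT : Measurable (Prod.map T T) := (hT.prodMap hT).measurable
  constructor
  · intro A hA
    have hA' : MeasurableSet (A ×ˢ (univ : Set Y)) := by
      rw [prod_univ]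
      exact (continuous_fst (X := Y) (Y := Y)).measurable hA
    rw [Measure.map_apply hTT hA', Measure.map_apply hT.measurable hA,
      ← hπ.1 _ (hT.measurable hA), Set.preimage_prod_map_prod, preimage_univ]
  · intro A hA
    have hA' : MeasurableSet ((univ : Set Y) ×ˢ A) := by
      rw [univ_prod]
      exact (continuous_snd (X := Y) (Y := Y)).measurable hA
    rw [Measure.map_apply hTT hA', Measure.map_apply hT.measurable hA,
      ← hπ.2 _ (hT.measurable hA), Set.preimage_prod_map_prod, preimage_univ]

theorem wassersteinDist_map_le {p : ℝ} (hp : 0 < p) {T : X → Y} (hT : Continuous T)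
    {s : Set X} {K : ℝ≥0∞} (hK0 : K ≠ 0) (hK : K ≠ ⊤)
    (hLip : ∀ x ∈ s, ∀ y ∈ s, edist (T x) (T y) ≤ K * edist x y)
    {P Q : Measure X} (hP : ∀ᵐ x ∂P, x ∈ s) (hQ : ∀ᵐ x ∂Q, x ∈ s) :
    wassersteinDist p (P.map T) (Q.map T) ≤ K * wassersteinDist p P Q := by
  let _ : MeasurableSpace (X × X) := borel (X × X)
  let _ : MeasurableSpace (Y × Y) := borel (Y × Y)
  have : BorelSpace (X × X) := ⟨rfl⟩
  have : BorelSpace (Y × Y) := ⟨rfl⟩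
  -- Dividing by `K` also covers the case that there is no coupling of `P` and `Q`.
  rw [← ENNReal.div_le_iff' hK0 hK]
  refine le_iInf₂ fun π hπ => ?_
  rw [ENNReal.div_le_iff' hK0 hK]
  refine (iInf₂_le _ (hπ.map hT)).trans ?_
  have hint : ∫⁻ z, edist z.1 z.2 ^ p ∂(Measure.map (Prod.map T T) π)
      ≤ K ^ p * ∫⁻ z, edist z.1 z.2 ^ p ∂π := by
    refine (lintegral_map_le _ _).trans ?_
    rw [← lintegral_const_mul' _ _ (ENNReal.rpow_ne_top_of_nonneg hp.le hK)]
    refine lintegral_mono_ae ?_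
    filter_upwards [hπ.ae_mem_prod hP hQ] with z hz
    rw [← ENNReal.mul_rpow_of_nonneg _ _ hp.le]
    exact ENNReal.rpow_le_rpow (hLip _ hz.1 _ hz.2) hp.le
  calc (∫⁻ z, edist z.1 z.2 ^ p ∂(Measure.map (Prod.map T T) π)) ^ (1 / p)
      ≤ (K ^ p * ∫⁻ z, edist z.1 z.2 ^ p ∂π) ^ (1 / p) :=
        ENNReal.rpow_le_rpow hint (by positivity)
    _ = K * (∫⁻ z, edist z.1 z.2 ^ p ∂π) ^ (1 / p) := by
        rw [ENNReal.mul_rpow_of_nonneg _ _ (by positivity), ← ENNReal.rpow_mul,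
          mul_one_div_cancel hp.ne', ENNReal.rpow_one]

end Wasserstein

theorem hasFiniteMoment_map_of_ae_edist_le {X Y : Type*} [MeasurableSpace X]
    [MetricSpace Y] [MeasurableSpace Y] {p : ℝ} (hp : 0 ≤ p) {T : X → Y}
    (hT : Measurable T) {P : Measure X} [IsProbabilityMeasure P] {y₀ : Y} {M : ℝ≥0∞}
    (hM : M ≠ ⊤) (h : ∀ᵐ x ∂P, edist (T x) y₀ ≤ M) : HasFiniteMoment p (P.map T) := by
  refine ⟨Measure.isProbabilityMeasure_map hT.aemeasurable, y₀, ?_⟩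
  calc ∫⁻ y, edist y y₀ ^ p ∂(P.map T) ≤ ∫⁻ x, edist (T x) y₀ ^ p ∂P := lintegral_map_le _ _
    _ ≤ ∫⁻ _, M ^ p ∂P := by
        refine lintegral_mono_ae ?_
        filter_upwards [h] with x hx
        exact ENNReal.rpow_le_rpow hx hp
    _ = M ^ p := by simp
    _ < ⊤ := (ENNReal.rpow_ne_top_of_nonneg hp hM).lt_top

section Elliptic

variable {d : ℕ} {D : Set (EuclideanSpace ℝ (Fin d))}

/-! ### The Poincaré inequality -/

/-- Integration by parts against the `i`-th coordinate, whose derivative in direction `i` is `1`. -/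
theorem integral_sq_eq_neg_integral_coord_mul_gradient {φ : EuclideanSpace ℝ (Fin d) → ℝ}
    (hφ : ContDiff ℝ ∞ φ) (cφ : HasCompactSupport φ) (i : Fin d) :
    ∫ x, φ x ^ 2 = -∫ x, 2 * (φ x * (x i * ∇ φ x i)) := by
  have hd : ∀ x, DifferentiableAt ℝ φ x := fun x => hφ.differentiable (by simp) x
  set e : EuclideanSpace ℝ (Fin d) := EuclideanSpace.single i 1
  have hgrad : ∀ x, fderiv ℝ φ x e = ∇ φ x i := by
    intro x
    rw [← inner_gradient_left, EuclideanSpace.inner_single_right]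
    simp
  have hsq : ∀ x, fderiv ℝ (fun x => φ x ^ 2) x e = 2 * φ x * ∇ φ x i := by
    intro x
    rw [fderiv_fun_pow 2 (hd x)]
    simp [hgrad]
  have hcoord : ∀ x, fderiv ℝ (fun x : EuclideanSpace ℝ (Fin d) => x i) x e = 1 := by
    intro x
    have : (fun x : EuclideanSpace ℝ (Fin d) => x i) = EuclideanSpace.proj (𝕜 := ℝ) i := rfl
    rw [this, ContinuousLinearMap.fderiv]
    simp [e]
  have cφ2 : HasCompactSupport fun x => φ x ^ 2 := cφ.comp_left (g := fun t => t ^ 2) (by simp)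
  have hc1 : Continuous fun x => fderiv ℝ (fun x => φ x ^ 2) x e :=
    ((hφ.pow 2).continuous_fderiv (by simp)).clm_apply continuous_const
  have hc2 : Continuous fun x : EuclideanSpace ℝ (Fin d) => x i := by fun_prop
  have key := integral_mul_fderiv_eq_neg_fderiv_mul_of_integrable (μ := volume)
    (f := fun x => φ x ^ 2) (g := fun x : EuclideanSpace ℝ (Fin d) => x i) (v := e)
    ((hc1.mul hc2).integrable_of_hasCompactSupport (cφ2.fderiv_apply (𝕜 := ℝ) e).mul_right)
    (by
      simp only [hcoord, mul_one]
      exact (hφ.continuous.pow 2).integrable_of_hasCompactSupport cφ2)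
    (((hφ.continuous.pow 2).mul hc2).integrable_of_hasCompactSupport cφ2.mul_right)
    (fun x _ => (hd x).pow 2) (fun x _ => by fun_prop)
  simp only [hcoord, mul_one, hsq] at key
  rw [key]
  congr 2
  ext x
  ring

/-- The Poincaré inequality for test functions on a set of radius `R`: Cauchy–Schwarz for the
pairing of `φ` with `x_i ∂_i φ` in `∫ φ² = -2 ∫ φ x_i ∂_i φ`. -/
theorem norm_fst_le_of_mem_testGraph (i : Fin d) {R : ℝ} (hR : ∀ x ∈ D, ‖x‖ ≤ R) (hD : IsOpen D)
    {w : WithLp 2 (ScalarLp D 2 × VectorL2 D)} (hw : w ∈ testGraph D) :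
    ‖w.fst‖ ≤ 2 * R * ‖w.snd‖ := by
  obtain ⟨φ, hφ, cφ, sφ, w1, w2⟩ := hw
  have hgc : Continuous fun x => ∇ φ x :=
    (InnerProductSpace.toDual ℝ (EuclideanSpace ℝ (Fin d))).symm.continuous.comp
      (hφ.continuous_fderiv (by simp))
  have hgi : Continuous fun x => ∇ φ x i := by fun_prop
  have hgs : HasCompactSupport fun x => ∇ φ x i :=
    (cφ.fderiv (𝕜 := ℝ)).comp_left
      (g := fun l => (InnerProductSpace.toDual ℝ (EuclideanSpace ℝ (Fin d))).symm l i) (by simp)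
  have hmem : MemLp (fun x => x i * ∇ φ x i) 2 (volume.restrict D) :=
    (Continuous.memLp_of_hasCompactSupport (by fun_prop) hgs.mul_left).restrict D
  set h : ScalarLp D 2 := hmem.toLp _
  have hh : ‖h‖ ≤ R * ‖w.snd‖ := by
    refine Lp.norm_le_mul_norm_of_ae_le_mul ?_
    filter_upwards [hmem.coeFn_toLp, w2, ae_restrict_mem hD.measurableSet] with x h1 h2 hx
    rw [h1, h2, norm_mul]
    exact mul_le_mul ((PiLp.norm_apply_le x i).trans (hR x hx)) (PiLp.norm_apply_le _ i)
      (norm_nonneg _) ((norm_nonneg x).trans (hR x hx))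
  have hout : ∀ x, x ∉ D → φ x = 0 := fun x hx => image_eq_zero_of_notMem_tsupport fun h => hx (sφ h)
  have h1 : inner ℝ w.fst w.fst = ∫ x, φ x ^ 2 := by
    rw [L2.inner_def, ← setIntegral_eq_integral_of_forall_compl_eq_zero (s := D)
      (f := fun x => φ x ^ 2) (fun x hx => by simp [hout x hx])]
    refine integral_congr_ae ?_
    filter_upwards [w1] with x hx
    simp [hx, sq]
  have h2 : inner ℝ w.fst h = ∫ x, φ x * (x i * ∇ φ x i) := by
    rw [L2.inner_def, ← setIntegral_eq_integral_of_forall_compl_eq_zero (s := D)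
      (f := fun x => φ x * (x i * ∇ φ x i)) (fun x hx => by simp [hout x hx])]
    refine integral_congr_ae ?_
    filter_upwards [w1, hmem.coeFn_toLp] with x hx hx2
    rw [hx, hx2]
    simp [mul_comm]
  have h3 : ‖w.fst‖ ^ 2 = -(2 * inner ℝ w.fst h) := by
    rw [← real_inner_self_eq_norm_sq, h1, h2,
      integral_sq_eq_neg_integral_coord_mul_gradient hφ cφ i, integral_const_mul]
  have h4 : -inner ℝ w.fst h ≤ ‖w.fst‖ * ‖h‖ :=
    (neg_le_abs _).trans (abs_real_inner_le_norm _ _)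
  rcases (norm_nonneg w.fst).eq_or_lt with h0 | h0
  · rw [← h0] at h4 h3 ⊢
    have := norm_nonneg h
    linarith
  · have h5 : ‖w.fst‖ * ‖h‖ ≤ ‖w.fst‖ * (R * ‖w.snd‖) := by gcongr
    refine le_of_mul_le_mul_left ?_ h0
    linarith

/-- The Poincaré inequality on `H₀¹(D)`, in the form that the gradient controls the full norm. -/
theorem exists_norm_le_mul_norm_grad (hd : 1 ≤ d) (hD : IsOpen D)
    (hDb : Bornology.IsBounded D) :
    ∃ K : ℝ, 0 < K ∧ ∀ u : H10 D, ‖u‖ ≤ K * ‖u.grad‖ := by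
  obtain ⟨R, hR0, hR⟩ := hDb.exists_pos_norm_le
  refine ⟨1 + 2 * R, by positivity, fun u => ?_⟩
  have hcl : IsClosed {w : WithLp 2 (ScalarLp D 2 × VectorL2 D) | ‖w.fst‖ ≤ 2 * R * ‖w.snd‖} :=
    isClosed_le (by fun_prop) (by fun_prop)
  have hfn : ‖u.fn‖ ≤ 2 * R * ‖u.grad‖ :=
    closure_minimal (fun w hw => norm_fst_le_of_mem_testGraph ⟨0, hd⟩ hR hD hw) hcl u.2
  have h0 := norm_nonneg u.grad
  refine (pow_le_pow_iff_left₀ (norm_nonneg _) (by positivity) two_ne_zero).1 ?_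
  rw [H10.norm_sq]
  nlinarith [pow_le_pow_left₀ (norm_nonneg u.fn) hfn 2, mul_nonneg hR0.le (sq_nonneg ‖u.grad‖)]

/-! ### Energy estimates -/

theorem PosLinfty.ae_pos (a : PosLinfty D) : ∀ᵐ x ∂(volume.restrict D), 0 < a.toLp x := by
  obtain ⟨m, hm, h⟩ := a.uniformly_pos
  filter_upwards [h] with x hx
  exact hm.trans_le hx

theorem PosLinfty.coeFn_log (a : PosLinfty D) :
    a.log =ᵐ[volume.restrict D] fun x => Real.log (a.toLp x) :=
  a.memLp_log.coeFn_toLp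

theorem ae_abs_le_norm_Linfty (g : ScalarLp D ∞) : ∀ᵐ x ∂(volume.restrict D), |g x| ≤ ‖g‖ := by
  filter_upwards [ae_le_eLpNormEssSup (f := g) (μ := volume.restrict D)] with x hx
  rw [← eLpNorm_exponent_top] at hx
  rw [Lp.norm_def, ← Real.norm_eq_abs, ← toReal_enorm]
  exact ENNReal.toReal_mono (Lp.eLpNorm_ne_top _) hx

theorem PosLinfty.ae_exp_bounds {a : PosLinfty D} {r : ℝ} (h : ‖a.log‖ ≤ r) :
    ∀ᵐ x ∂(volume.restrict D), Real.exp (-r) ≤ a.toLp x ∧ a.toLp x ≤ Real.exp r := by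
  filter_upwards [a.ae_pos, a.coeFn_log, ae_abs_le_norm_Linfty a.log] with x h0 h1 h2
  rw [h1] at h2
  have h3 := abs_le.1 (h2.trans h)
  exact ⟨(Real.le_log_iff_exp_le h0).1 h3.1, (Real.log_le_iff_le_exp h0).1 h3.2⟩

/-- The exponential is `M`-Lipschitz where it is at most `M`, written in terms of the logarithm and
one-sided. -/
theorem Real.sub_le_mul_log_sub_log {s t M : ℝ} (hs : 0 < s) (ht : 0 < t) (hsM : s ≤ M) :
    s - t ≤ M * |Real.log s - Real.log t| := by
  have h1 : Real.log t - Real.log s ≤ t / s - 1 := by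
    rw [← Real.log_div ht.ne' hs.ne']
    exact Real.log_le_sub_one_of_pos (by positivity)
  have h2 : s - t ≤ s * (Real.log s - Real.log t) := by
    have h3 := mul_le_mul_of_nonneg_left h1 hs.le
    rw [mul_sub s (t / s), mul_div_cancel₀ t hs.ne'] at h3
    linarith
  calc s - t ≤ s * (Real.log s - Real.log t) := h2
    _ ≤ s * |Real.log s - Real.log t| := by
        gcongr
        exact le_abs_self _
    _ ≤ M * |Real.log s - Real.log t| := by gcongr

theorem PosLinfty.norm_toLp_sub_le {a b : PosLinfty D} {r : ℝ} (ha : ‖a.log‖ ≤ r)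
    (hb : ‖b.log‖ ≤ r) : ‖a.toLp - b.toLp‖ ≤ Real.exp r * ‖a.log - b.log‖ := by
  refine Lp.norm_le_mul_norm_of_ae_le_mul ?_
  filter_upwards [a.ae_pos, b.ae_pos, a.coeFn_log, b.coeFn_log, PosLinfty.ae_exp_bounds ha,
    PosLinfty.ae_exp_bounds hb, Lp.coeFn_sub a.toLp b.toLp, Lp.coeFn_sub a.log b.log]
    with x a0 b0 al bl ae be h1 h2
  rw [h1, h2, Pi.sub_apply, Pi.sub_apply, al, bl, Real.norm_eq_abs, Real.norm_eq_abs, abs_le']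
  refine ⟨Real.sub_le_mul_log_sub_log a0 b0 ae.2, ?_⟩
  rw [neg_sub, abs_sub_comm]
  exact Real.sub_le_mul_log_sub_log b0 a0 be.2

/-- A pointwise lower bound for the coefficient bounds the energy from below. -/
theorem mul_norm_sq_le_inner_smul_self {g : ScalarLp D ∞} {m : ℝ}
    (hm : ∀ᵐ x ∂(volume.restrict D), m ≤ g x) (F : VectorL2 D) :
    m * ‖F‖ ^ 2 ≤ inner ℝ (g • F : VectorL2 D) F := by
  rw [← real_inner_self_eq_norm_sq, ← real_inner_smul_left, L2.inner_def, L2.inner_def]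
  refine integral_mono_ae (L2.integrable_inner _ _) (L2.integrable_inner _ _) ?_
  filter_upwards [hm, Lp.coeFn_lpSMul (r := 2) g F, Lp.coeFn_smul m F] with x h1 h2 h3
  rw [h2, h3, Pi.smul_apply, Pi.smul_apply', real_inner_smul_left, real_inner_smul_left]
  exact mul_le_mul_of_nonneg_right h1 real_inner_self_nonneg

/-- The weak formulation in terms of the `L²` inner products and the product `L^∞ · L² ⊆ L²`. -/
theorem isWeakSolution_iff_inner {x : DataSpace D} {u : H10 D} :
    IsWeakSolution x u ↔
      ∀ v : H10 D, inner ℝ (x.a.toLp • u.grad : VectorL2 D) v.grad = inner ℝ x.f v.fn := by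
  refine forall_congr' fun v => ?_
  have h1 : ∫ y in D, x.a.toLp y * inner ℝ (u.grad y) (v.grad y)
      = inner ℝ (x.a.toLp • u.grad : VectorL2 D) v.grad := by
    rw [L2.inner_def]
    refine integral_congr_ae ?_
    filter_upwards [Lp.coeFn_lpSMul (r := 2) x.a.toLp u.grad] with y hy
    rw [hy, Pi.smul_apply', real_inner_smul_left]
  have h2 : ∫ y in D, x.f y * v.fn y = inner ℝ x.f v.fn := by
    rw [L2.inner_def]
    simp [mul_comm]
  rw [h1, h2]

theorem H10.norm_fn_le (u : H10 D) : ‖u.fn‖ ≤ ‖u‖ := by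
  refine (pow_le_pow_iff_left₀ (norm_nonneg _) (norm_nonneg _) two_ne_zero).1 ?_
  rw [H10.norm_sq]
  exact le_add_of_nonneg_right (sq_nonneg _)

theorem H10.norm_grad_le (u : H10 D) : ‖u.grad‖ ≤ ‖u‖ := by
  refine (pow_le_pow_iff_left₀ (norm_nonneg _) (norm_nonneg _) two_ne_zero).1 ?_
  rw [H10.norm_sq]
  exact le_add_of_nonneg_left (sq_nonneg _)

/-- The energy estimate: an upper bound for the energy that is linear in `‖∇w‖` bounds `‖∇w‖`. -/
theorem norm_grad_le_of_energy_le {a : PosLinfty D} {r B : ℝ} (ha : ‖a.log‖ ≤ r) (hB : 0 ≤ B)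
    {w : H10 D} (h : inner ℝ (a.toLp • w.grad : VectorL2 D) w.grad ≤ B * ‖w.grad‖) :
    ‖w.grad‖ ≤ Real.exp r * B := by
  have h1 := (mul_norm_sq_le_inner_smul_self
    ((PosLinfty.ae_exp_bounds ha).mono fun x hx => hx.1) w.grad).trans h
  rcases (norm_nonneg w.grad).eq_or_lt with h0 | h0
  · rw [← h0]
    positivity
  · have h2 : Real.exp (-r) * ‖w.grad‖ ≤ B := by
      refine le_of_mul_le_mul_right ?_ h0
      linarith
    rwa [Real.exp_neg, inv_mul_le_iff₀ (Real.exp_pos r)] at h2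

section Poincare

variable {K : ℝ} (hK : 0 < K) (hP : ∀ u : H10 D, ‖u‖ ≤ K * ‖u.grad‖)

include hK hP

theorem IsWeakSolution.norm_grad_le {x : DataSpace D} {u : H10 D} (hu : IsWeakSolution x u)
    {r : ℝ} (hx : ‖x.a.log‖ ≤ r) : ‖u.grad‖ ≤ Real.exp r * (K * ‖x.f‖) := by
  refine norm_grad_le_of_energy_le hx (by positivity) ?_
  rw [isWeakSolution_iff_inner.1 hu u]
  calc inner ℝ x.f u.fn ≤ ‖x.f‖ * ‖u.fn‖ := real_inner_le_norm _ _
    _ ≤ ‖x.f‖ * (K * ‖u.grad‖) := by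
        gcongr
        exact u.norm_fn_le.trans (hP u)
    _ = K * ‖x.f‖ * ‖u.grad‖ := by ring

/-- The difference of two solutions solves a problem whose right-hand side is
`f₁ - f₂ + div ((a₁ - a₂) ∇u₂)`; the three factors `exp r` come from the coercivity constant, from
`‖a₁ - a₂‖ ≤ exp r ‖log a₁ - log a₂‖`, and from the bound for `∇u₂`. -/
theorem IsWeakSolution.norm_sub_le {x y : DataSpace D} {u v : H10 D} (hu : IsWeakSolution x u)
    (hv : IsWeakSolution y v) {r : ℝ} (hx : x ∈ boundedData D r) (hy : y ∈ boundedData D r) :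
    ‖u - v‖ ≤ K ^ 2 * (1 + r) * Real.exp (3 * r) * dist x y := by
  have hr : 0 ≤ r := (norm_nonneg _).trans hx.1
  set w : H10 D := u - v
  have hwg : w.grad = u.grad - v.grad := rfl
  set B : ℝ := K * ‖x.f - y.f‖ +
    Real.exp r * ‖x.a.log - y.a.log‖ * (Real.exp r * (K * r)) with hBdef
  have hB : 0 ≤ B := by positivity
  have hsplit : inner ℝ (x.a.toLp • w.grad : VectorL2 D) w.grad
      = inner ℝ (x.f - y.f) w.fn
        - inner ℝ ((x.a.toLp - y.a.toLp) • v.grad : VectorL2 D) w.grad := by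
    have h1 : (x.a.toLp • w.grad : VectorL2 D)
        = x.a.toLp • u.grad - y.a.toLp • v.grad - (x.a.toLp - y.a.toLp) • v.grad := by
      rw [hwg, sub_eq_add_neg u.grad, Lp.add_smul, Lp.smul_neg, sub_eq_add_neg x.a.toLp,
        Lp.smul_add, Lp.neg_smul]
      abel
    rw [h1, inner_sub_left, inner_sub_left, isWeakSolution_iff_inner.1 hu w,
      isWeakSolution_iff_inner.1 hv w, inner_sub_left]
  have hvg : ‖v.grad‖ ≤ Real.exp r * (K * r) := by
    refine (hv.norm_grad_le hK hP hy.1).trans ?_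
    gcongr
    exact hy.2
  have henergy : inner ℝ (x.a.toLp • w.grad : VectorL2 D) w.grad ≤ B * ‖w.grad‖ := by
    have h1 : inner ℝ (x.f - y.f) w.fn ≤ ‖x.f - y.f‖ * (K * ‖w.grad‖) := by
      refine (real_inner_le_norm _ _).trans ?_
      gcongr
      exact w.norm_fn_le.trans (hP w)
    have h2 : -inner ℝ ((x.a.toLp - y.a.toLp) • v.grad : VectorL2 D) w.grad
        ≤ Real.exp r * ‖x.a.log - y.a.log‖ * (Real.exp r * (K * r)) * ‖w.grad‖ := by
      refine (neg_le_abs _).trans ((abs_real_inner_le_norm _ _).trans ?_)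
      gcongr
      refine (Lp.norm_smul_le _ _).trans ?_
      gcongr
      exact PosLinfty.norm_toLp_sub_le hx.1 hy.1
    rw [hsplit, hBdef, add_mul]
    linarith
  have hgrad := norm_grad_le_of_energy_le hx.1 hB henergy
  have h3 : Real.exp (3 * r) = Real.exp r * Real.exp r * Real.exp r := by
    rw [← Real.exp_add, ← Real.exp_add]
    ring_nf
  have h1 : 1 ≤ Real.exp r := Real.one_le_exp hr
  rw [DataSpace.dist_eq, h3]
  set E := Real.exp r
  set δ := ‖x.a.log - y.a.log‖
  set η := ‖x.f - y.f‖
  have hδ : 0 ≤ δ := norm_nonneg _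
  have hη : 0 ≤ η := norm_nonneg _
  calc ‖w‖ ≤ K * (E * B) := (hP w).trans (by gcongr)
    _ = K ^ 2 * (E * 1 * 1 * (1 * η) + E * E * E * (r * δ)) := by rw [hBdef]; ring
    _ ≤ K ^ 2 * (E * E * E * ((1 + r) * η) + E * E * E * ((1 + r) * δ)) := by
        gcongr <;> linarith
    _ = K ^ 2 * (1 + r) * (E * E * E) * (δ + η) := by ring

end Poincare

/-! ### Existence of solutions and the solution operator -/

instance : CompleteSpace (H10 D) :=
  inferInstanceAs (CompleteSpace (testGraph D).topologicalClosure)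

/-- The gradient as a bounded operator on `H₀¹(D)`. -/
noncomputable def H10.gradL (D : Set (EuclideanSpace ℝ (Fin d))) : H10 D →L[ℝ] VectorL2 D :=
  LinearMap.mkContinuous
    { toFun := H10.grad, map_add' := fun _ _ => rfl, map_smul' := fun _ _ => rfl } 1
    fun u => (one_mul ‖u‖).symm ▸ u.norm_grad_le

/-- The embedding of `H₀¹(D)` into `L²(D)` as a bounded operator. -/
noncomputable def H10.fnL (D : Set (EuclideanSpace ℝ (Fin d))) : H10 D →L[ℝ] ScalarLp D 2 :=
  LinearMap.mkContinuous
    { toFun := H10.fn, map_add' := fun _ _ => rfl, map_smul' := fun _ _ => rfl } 1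
    fun u => (one_mul ‖u‖).symm ▸ u.norm_fn_le

/-- The energy form `(u, v) ↦ ∫ a ∇u · ∇v` on `H₀¹(D)`. -/
noncomputable def energyForm (a : ScalarLp D ∞) : H10 D →L[ℝ] H10 D →L[ℝ] ℝ :=
  LinearMap.mkContinuous₂
    (LinearMap.mk₂ ℝ (fun u v : H10 D => inner ℝ (a • u.grad : VectorL2 D) v.grad)
      (fun u v w => by
        change inner ℝ (a • (u.grad + v.grad) : VectorL2 D) w.grad = _
        rw [Lp.add_smul, inner_add_left])
      (fun c u w => by
        change inner ℝ (a • c • u.grad : VectorL2 D) w.grad = _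
        rw [← Lp.smul_comm, real_inner_smul_left, smul_eq_mul])
      (fun u v w => inner_add_right _ _ _)
      (fun c u w => real_inner_smul_right _ _ _)) ‖a‖
    fun u v => by
      change |inner ℝ (a • u.grad : VectorL2 D) v.grad| ≤ _
      refine (abs_real_inner_le_norm _ _).trans ?_
      gcongr
      · refine (Lp.norm_smul_le _ _).trans ?_
        gcongr
        exact u.norm_grad_le
      · exact v.norm_grad_le

@[simp]
theorem energyForm_apply (a : ScalarLp D ∞) (u v : H10 D) :
    energyForm a u v = inner ℝ (a • u.grad : VectorL2 D) v.grad := rfl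

section Poincare

variable {K : ℝ} (hK : 0 < K) (hP : ∀ u : H10 D, ‖u‖ ≤ K * ‖u.grad‖)

include hK hP

theorem isCoercive_energyForm (a : PosLinfty D) : IsCoercive (energyForm a.toLp) := by
  obtain ⟨m, hm, ha⟩ := a.uniformly_pos
  refine ⟨m / K ^ 2, by positivity, fun u => ?_⟩
  refine le_trans ?_ (mul_norm_sq_le_inner_smul_self ha u.grad)
  calc m / K ^ 2 * ‖u‖ * ‖u‖ = m / K ^ 2 * ‖u‖ ^ 2 := by ring
    _ ≤ m / K ^ 2 * (K * ‖u.grad‖) ^ 2 := by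
        gcongr
        exact hP u
    _ = m * ‖u.grad‖ ^ 2 := by
        field_simp

/-- Lax–Milgram for the energy form. -/
theorem existsUnique_isWeakSolution (x : DataSpace D) : ∃! u : H10 D, IsWeakSolution x u := by
  refine existsUnique_of_exists_of_unique ?_ fun u v hu hv => ?_
  · have hc := isCoercive_energyForm hK hP x.a
    set ℓ : StrongDual ℝ (H10 D) := (innerSL ℝ x.f).comp (H10.fnL D)
    refine ⟨hc.continuousLinearEquivOfBilin.symm
      ((InnerProductSpace.toDual ℝ (H10 D)).symm ℓ), isWeakSolution_iff_inner.2 fun v => ?_⟩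
    rw [← energyForm_apply, ← hc.continuousLinearEquivOfBilin_apply,
      ContinuousLinearEquiv.apply_symm_apply, InnerProductSpace.toDual_symm_apply]
    rfl
  · have hx : x ∈ boundedData D (max ‖x.a.log‖ ‖x.f‖) := ⟨le_max_left _ _, le_max_right _ _⟩
    have h := hu.norm_sub_le hK hP hv hx hx
    rw [dist_self, mul_zero] at h
    exact sub_eq_zero.1 (norm_le_zero_iff.1 h)

theorem isWeakSolution_solutionOperator (x : DataSpace D) :
    IsWeakSolution x (solutionOperator D x) := by
  have h := (existsUnique_isWeakSolution hK hP x).exists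
  rw [solutionOperator, dif_pos h]
  exact h.choose_spec

theorem dist_solutionOperator_le {r : ℝ} {x y : DataSpace D} (hx : x ∈ boundedData D r)
    (hy : y ∈ boundedData D r) :
    dist (solutionOperator D x) (solutionOperator D y)
      ≤ K ^ 2 * (1 + r) * Real.exp (3 * r) * dist x y := by
  rw [dist_eq_norm]
  exact (isWeakSolution_solutionOperator hK hP x).norm_sub_le hK hP
    (isWeakSolution_solutionOperator hK hP y) hx hy

/-- Bounded subsets of the data space lie in some `boundedData D r`, so the Lipschitz estimates on
these sets give continuity. -/
theorem continuous_solutionOperator : Continuous (solutionOperator D) := by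
  refine continuous_iff_continuousAt.2 fun x => ?_
  set r : ℝ := ‖x.a.log‖ + ‖x.f‖ + 1 with hr
  have hball : ∀ y ∈ Metric.ball x 1, y ∈ boundedData D r := by
    intro y hy
    rw [Metric.mem_ball, DataSpace.dist_eq] at hy
    have h1 := norm_le_norm_add_norm_sub' y.a.log x.a.log
    have h2 := norm_le_norm_add_norm_sub' y.f x.f
    have h3 := norm_nonneg (y.a.log - x.a.log)
    have h4 := norm_nonneg (y.f - x.f)
    have h5 := norm_nonneg x.a.log
    have h6 := norm_nonneg x.f
    constructor <;> linarith
  refine continuousAt_of_locally_lipschitz one_pos (K ^ 2 * (1 + r) * Real.exp (3 * r))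
    fun y hy => ?_
  exact dist_solutionOperator_le hK hP (hball y hy) (hball x (Metric.mem_ball_self one_pos))

theorem norm_solutionOperator_le {r : ℝ} {x : DataSpace D} (hx : x ∈ boundedData D r) :
    ‖solutionOperator D x‖ ≤ K * (Real.exp r * (K * r)) := by
  refine (hP _).trans ?_
  gcongr
  refine ((isWeakSolution_solutionOperator hK hP x).norm_grad_le hK hP hx.1).trans ?_
  gcongr
  exact hx.2

theorem hasFiniteMoment_map_solutionOperator {r p : ℝ} (hp : 0 ≤ p) {P : Measure (DataSpace D)}
    [IsProbabilityMeasure P] (h : ∀ᵐ x ∂P, x ∈ boundedData D r) :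
    HasFiniteMoment p (P.map (solutionOperator D)) := by
  refine hasFiniteMoment_map_of_ae_edist_le hp (continuous_solutionOperator hK hP).measurable
    (y₀ := 0) (M := ENNReal.ofReal (K * (Real.exp r * (K * r)))) ENNReal.ofReal_ne_top ?_
  filter_upwards [h] with x hx
  rw [edist_dist, dist_zero_right]
  exact ENNReal.ofReal_le_ofReal (norm_solutionOperator_le hK hP hx)

end Poincare

end Elliptic

theorem mainTheorem9 {d : ℕ} (hd : 1 ≤ d) (D : Set (EuclideanSpace ℝ (Fin d)))
    (hD : IsOpen D) (hDb : Bornology.IsBounded D) :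
    (∀ x : DataSpace D, ∃! u : H10 D, IsWeakSolution x u) ∧
    Measurable (solutionOperator D) ∧
    ∃ c : ℝ, 0 < c ∧
      ∀ (r p : ℝ), 1 ≤ p →
      ∀ (P Q : Measure (DataSpace D)), IsProbabilityMeasure P → IsProbabilityMeasure Q →
        (∀ᵐ x ∂P, x ∈ boundedData D r) → (∀ᵐ x ∂Q, x ∈ boundedData D r) →
        HasFiniteMoment p (P.map (solutionOperator D)) ∧
        HasFiniteMoment p (Q.map (solutionOperator D)) ∧
        wassersteinDist p (P.map (solutionOperator D)) (Q.map (solutionOperator D)) ≤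
          ENNReal.ofReal (c * (1 + r) * Real.exp (3 * r)) * wassersteinDist p P Q := by
  obtain ⟨K, hK, hP⟩ := exists_norm_le_mul_norm_grad hd hD hDb
  refine ⟨existsUnique_isWeakSolution hK hP, (continuous_solutionOperator hK hP).measurable,
    K ^ 2, by positivity, fun r p hp P Q _ _ hPr hQr => ?_⟩
  have hp0 : 0 < p := one_pos.trans_le hp
  -- A probability measure can be carried by `boundedData D r` only if this set is nonempty.
  have hr : 0 ≤ r := by
    obtain ⟨x, hx⟩ := hPr.exists
    exact (norm_nonneg _).trans hx.2
  have hc : 0 < K ^ 2 * (1 + r) * Real.exp (3 * r) := by positivity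
  refine ⟨hasFiniteMoment_map_solutionOperator hK hP hp0.le hPr,
    hasFiniteMoment_map_solutionOperator hK hP hp0.le hQr,
    wassersteinDist_map_le hp0 (continuous_solutionOperator hK hP)
      (ENNReal.ofReal_pos.2 hc).ne' ENNReal.ofReal_ne_top (fun x hx y hy => ?_) hPr hQr⟩
  rw [edist_dist, edist_dist, ← ENNReal.ofReal_mul hc.le]
  exact ENNReal.ofReal_le_ofReal (dist_solutionOperator_le hK hP hx hy)
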